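/- Let $N,T,S$ be nonnegative integers with $1\le S\le T$. For integers $0\le s\le T$ let $\Omega(N,T,s)$ be the finite set of families $X=(\tau_1,\dots,\tau_N)$ of $N$ non-intersecting lattice paths made of segments of slopes $0$ and $1$, where $\tau_i$ goes from $(0,i-1)$ to $(T,s+i-1)$, and let $\mu(N,T,s)$ be the uniform probability measure on $\Omega(N,T,s)$. For $0\le t\le T$ put $$\mathfrak X^{s,t}=\{x\in\mathbb Z:\max(0,t+s-T)\le x\le\min(t+N-1,s+N-1)\},\qquad \mathcal X^{s,t}=\{(x_1<\dots<x_N): x_i\in\mathfrak X^{s,t}\}.$$ For $X\in\Omega(N,T,s)$ write $X(t)=(\tau_1(t),\dots,\tau_N(t))\in\mathcal X^{s,t}$. With $(a)_N=a(a+1)\cdots(a+N-1)$, define for $0\le t<T$ the $\mathcal X^{s,t}\times\mathcal X^{s,t+1}$ matrix $$P^{s,t}_{t+}(x,y)=\frac{\prod_{i<j}(y_j-y_i)\prod_{i:\,y_i=x_i+1}(N+s-x_i-1)\prod_{i:\,y_i=x_i}(x_i+T-t-s)}{(T-t)_N\prod_{i<j}(x_j-x_i)}$$ if $y_i-x_i\in\{0,1\}$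 for all $i$, and $P^{s,t}_{t+}(x,y)=0$ otherwise; and, for $0\le s<T$ and $0\le t\le T$, the $\mathcal X^{s,t}\times\mathcal X^{s+1,t}$ matrix $$P^{s,t}_{S+}(x,y)=\frac{\prod_{i<j}(y_j-y_i)\prod_{i:\,y_i=x_i+1}(N+t-x_i-1)\prod_{i:\,y_i=x_i}(x_i+T-t-s)}{(T-s)_N\prod_{i<j}(x_j-x_i)}$$ if $y_i-x_i\in\{0,1\}$ for all $i$, and $P^{s,t}_{S+}(x,y)=0$ otherwise. For $X\in\Omega(N,T,S)$ and $Y\in\Omega(N,T,S-1)$ define $$P^S_{S\mapsto S-1}(X,Y)=\prod_{t=0}^{T-1}\frac{P^{S-1,t}_{t+}(Y(t),Y(t+1))\,P^{S-1,t+1}_{S+}(Y(t+1),X(t+1))}{(P^{S-1,t}_{t+}P^{S-1,t+1}_{S+})(Y(t),X(t+1))}$$ if $\prod_{t=0}^{T-1}(P^{S-1,t}_{t+}P^{S-1,t+1}_{S+})(Y(t),X(t+1))>0$, and $P^S_{S\mapsto S-1}(X,Y)=0$ otherwise. Then the matrix $P^S_{S\mapsto S-1}$ is stochastic, that is, its entries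 are nonnegative and $\sum_{Y\in\Omega(N,T,S-1)}P^S_{S\mapsto S-1}(X,Y)=1$ for every $X\in\Omega(N,T,S)$. Moreover it maps $\mu(N,T,S)$ to $\mu(N,T,S-1)$: for every $Y\in\Omega(N,T,S-1)$, $$\mu(N,T,S-1)(Y)=\sum_{X\in\Omega(N,T,S)}P^S_{S\mapsto S-1}(X,Y)\,\mu(N,T,S)(X).$$ -/

import Mathlib

open Finset

noncomputable section

namespace LozengePaths

/-- The section `{x ∈ ℤ : max(0, t+S-T) ≤ x ≤ min(t+N-1, S+N-1)}` of the hexagon by the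
vertical line with coordinate `t`. -/
def vertSection (N T S t : ℕ) : Finset ℤ :=
  Finset.Icc (max 0 ((t : ℤ) + S - T)) (min ((t : ℤ) + N - 1) ((S : ℤ) + N - 1))

/-- `N`-tuples `x₁ < x₂ < ⋯ < x_N` of points of the section `vertSection N T S t`. -/
def Config (N T S t : ℕ) : Type :=
  {x : Fin N → vertSection N T S t // StrictMono x}

open Classical in
instance (N T S t : ℕ) : Fintype (Config N T S t) :=
  inferInstanceAs (Fintype {x : Fin N → vertSection N T S t // StrictMono x})

/-- The `i`-th coordinate of a configuration, as an integer. -/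
def Config.pt {N T S t : ℕ} (X : Config N T S t) (i : Fin N) : ℤ := (X.1 i : ℤ)

/-- `∏_{i<j} (x_j - x_i)`. -/
def vdm {N T S t : ℕ} (X : Config N T S t) : ℝ :=
  ∏ i : Fin N, ∏ j ∈ Finset.Ioi i, ((X.pt j : ℝ) - (X.pt i : ℝ))

open Classical in
/-- The matrix `P^{S,t}_{t+}`. The Pochhammer symbol `(a)_N = a(a+1)⋯(a+N-1)` is
`(ascPochhammer ℝ N).eval a`. -/
def PtPlus (N T S t : ℕ) : Matrix (Config N T S t) (Config N T S (t + 1)) ℝ :=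
  Matrix.of fun X Y =>
    if ∀ i, Y.pt i - X.pt i = 0 ∨ Y.pt i - X.pt i = 1 then
      (vdm Y
        * (∏ i : Fin N with Y.pt i = X.pt i + 1, ((N : ℝ) + S - (X.pt i : ℝ) - 1))
        * (∏ i : Fin N with Y.pt i = X.pt i, ((X.pt i : ℝ) + T - t - S)))
      / ((ascPochhammer ℝ N).eval ((T : ℝ) - t) * vdm X)
    else 0

open Classical in
/-- The matrix `P^{S,t}_{S+}`. -/
def PSPlus (N T S t : ℕ) : Matrix (Config N T S t) (Config N T (S + 1) t) ℝ :=
  Matrix.of fun X Y =>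
    if ∀ i, Y.pt i - X.pt i = 0 ∨ Y.pt i - X.pt i = 1 then
      (vdm Y
        * (∏ i : Fin N with Y.pt i = X.pt i + 1, ((N : ℝ) + t - (X.pt i : ℝ) - 1))
        * (∏ i : Fin N with Y.pt i = X.pt i, ((X.pt i : ℝ) + T - t - S)))
      / ((ascPochhammer ℝ N).eval ((T : ℝ) - S) * vdm X)
    else 0

/-- `Ω(N,T,S)`: families of `N` non-intersecting lattice paths with steps of slope 0 or 1; the
path with (zero-based) index `i` goes from `(0, i)` to `(T, S + i)`. Since all steps have slope
0 or 1, two paths intersect exactly when they have a common lattice point. -/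
@[ext] structure PathFamily (N T S : ℕ) where
  /-- `path i t` is the height of the `i`-th path at time `t`. -/
  path : Fin N → Fin (T + 1) → ℤ
  start : ∀ i, path i 0 = (i : ℕ)
  finish : ∀ i, path i (Fin.last T) = (S : ℤ) + (i : ℕ)
  step : ∀ i (t : Fin T),
    path i t.succ - path i t.castSucc = 0 ∨ path i t.succ - path i t.castSucc = 1
  nonIntersecting : ∀ i j, i ≠ j → ∀ t, path i t ≠ path j t

namespace PathFamily

variable {N T S : ℕ}

theorem strictMono_path (X : PathFamily N T S) (t : Fin (T + 1)) :
    StrictMono fun i => X.path i t := by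
  intro i j hij
  induction t using Fin.induction with
  | zero =>
    simp only [X.start]
    exact_mod_cast hij
  | succ t ih =>
    have h1 := X.step i t
    have h2 := X.step j t
    have h3 := X.nonIntersecting i j hij.ne t.succ
    simp only at ih ⊢
    omega

theorem path_bounds_start (X : PathFamily N T S) (i : Fin N) (t : Fin (T + 1)) :
    (i : ℕ) ≤ X.path i t ∧ X.path i t ≤ (i : ℕ) + (t : ℕ) := by
  induction t using Fin.induction with
  | zero => simp [X.start]
  | succ t ih =>
    have h1 := X.step i t
    simp only [Fin.val_castSucc, Fin.val_succ] at ih ⊢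
    push_cast
    omega

theorem path_bounds_finish (X : PathFamily N T S) (i : Fin N) (t : Fin (T + 1)) :
    (S : ℤ) + (i : ℕ) + (t : ℕ) - T ≤ X.path i t ∧ X.path i t ≤ (S : ℤ) + (i : ℕ) := by
  induction t using Fin.reverseInduction with
  | last => simp [X.finish]
  | cast t ih =>
    have h1 := X.step i t
    simp only [Fin.val_castSucc, Fin.val_succ] at ih ⊢
    push_cast at ih
    omega

theorem path_mem (X : PathFamily N T S) (i : Fin N) (t : Fin (T + 1)) :
    X.path i t ∈ vertSection N T S t := by
  have h1 := X.path_bounds_start i t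
  have h2 := X.path_bounds_finish i t
  have h3 := i.isLt
  simp only [vertSection, Finset.mem_Icc]
  omega

/-- The configuration `X(t) = (τ₁(t), …, τ_N(t))`. -/
def slice (X : PathFamily N T S) (t : ℕ) (ht : t ≤ T) : Config N T S t :=
  ⟨fun i => ⟨X.path i ⟨t, Nat.lt_succ_of_le ht⟩, X.path_mem i ⟨t, Nat.lt_succ_of_le ht⟩⟩,
    fun _ _ hij => X.strictMono_path ⟨t, Nat.lt_succ_of_le ht⟩ hij⟩

instance : Finite (PathFamily N T S) := by
  let f : PathFamily N T S → ∀ (_ : Fin N) (t : Fin (T + 1)), vertSection N T S t :=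
    fun X i t => ⟨X.path i t, X.path_mem i t⟩
  refine Finite.of_injective f fun X Y h => ?_
  ext i t
  exact congrArg Subtype.val (congrFun (congrFun h i) t)

instance : Fintype (PathFamily N T S) := Fintype.ofFinite _

instance : MeasurableSpace (PathFamily N T S) := ⊤

end PathFamily

/-- The uniform measure `μ(N,T,S)` on `Ω(N,T,S)`. -/
def unifMeasure (N T S : ℕ) : MeasureTheory.Measure (PathFamily N T S) :=
  ProbabilityTheory.uniformOn Set.univ

open Classical in
/-- The matrix `P^{S+1}_{S+1 ↦ S}` with rows indexed by `Ω(N,T,S+1)` and columns indexed by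
`Ω(N,T,S)`. -/
def stepDown (N T S : ℕ) : Matrix (PathFamily N T (S + 1)) (PathFamily N T S) ℝ :=
  Matrix.of fun X Y =>
    if 0 < ∏ t : Fin T,
        (PtPlus N T S t * PSPlus N T S (t + 1))
          (Y.slice t t.isLt.le) (X.slice (t + 1) t.isLt) then
      ∏ t : Fin T,
        (PtPlus N T S t (Y.slice t t.isLt.le) (Y.slice (t + 1) t.isLt)
            * PSPlus N T S (t + 1) (Y.slice (t + 1) t.isLt) (X.slice (t + 1) t.isLt))
          / (PtPlus N T S t * PSPlus N T S (t + 1))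
              (Y.slice t t.isLt.le) (X.slice (t + 1) t.isLt)
    else 0

/-- A (possibly rectangular) real matrix is stochastic if its entries are nonnegative and each
row sums to `1`. -/
def IsStochastic {m n : Type*} [Fintype n] (P : Matrix m n ℝ) : Prop :=
  (∀ x y, 0 ≤ P x y) ∧ ∀ x, ∑ y, P x y = 1

end LozengePaths

end

/-! The engine is the commutation `P_{t+} P_{S+} = P_{S+} P_{t+}`. Each matrix is a product of
one-particle step weights conjugated by the Vandermonde product. Such a product is a minor of a
one-particle kernel (`det_stepWeight`), so Cauchy–Binet reduces commutation to the scalar identity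
`stepWeight_comm`.

For fixed `X`, a row of `stepDown` is a Markov chain for `Y` run forward in `t`. Its denominators
stay positive because `Y(t) → X(t) → X(t+1)` contributes to the same entry in the commuted order.
Hence the rows sum to 1.

For the columns, the product of `P_{t+}` along a path family is constant on each `Ω`
(`chainWeight_eq`). Up to constants, `stepDown X Y` is therefore the probability of `X` in a chain
conditioned on `Y` and run backward in `t`. So the column sums do not depend on `Y`, and the row
sums determine their common value. Stochasticity of `P_{t+}` and `P_{S+}` is never needed. -/

open Finset

noncomputable section

namespace LozengePaths

/-! ### Cauchy–Binet and sums over chains -/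

/-- The **Cauchy–Binet formula**, with the minors indexed by strictly increasing tuples. -/
theorem det_mul_eq_sum_strictMono {N : ℕ} {α R : Type*} [LinearOrder α] [Fintype α] [CommRing R]
    [Fintype {y : Fin N → α // StrictMono y}]
    (A : Matrix (Fin N) α R) (B : Matrix α (Fin N) R) :
    (A * B).det = ∑ y : {y : Fin N → α // StrictMono y},
      (A.submatrix id y.1).det * (B.submatrix y.1 id).det := by
  have hexpand : (A * B).det = ∑ p : Fin N → α, (∏ i, A i (p i)) * (B.submatrix p id).det := by
    have hrow : A * B = fun i => ∑ k, A i k • B k := by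
      ext i j
      simp [Matrix.mul_apply, Finset.sum_apply]
    rw [hrow]
    change (Matrix.detRowAlternating (n := Fin N) (R := R)).toMultilinearMap _ = _
    rw [MultilinearMap.map_sum]
    refine Finset.sum_congr rfl fun p _ => ?_
    rw [MultilinearMap.map_smul_univ, smul_eq_mul]
    rfl
  rw [hexpand]
  -- An injective tuple is uniquely a strictly increasing one composed with a permutation; a
  -- non-injective one repeats a row of the minor and contributes zero.
  have hreindex : ∑ q : {y : Fin N → α // StrictMono y} × Equiv.Perm (Fin N),
      (∏ i, A i (q.1.1 (q.2 i))) * (B.submatrix (q.1.1 ∘ q.2) id).det =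
      ∑ p : Fin N → α, (∏ i, A i (p i)) * (B.submatrix p id).det := by
    refine Fintype.sum_of_injective (fun q => q.1.1 ∘ q.2) ?_ _ _ ?_ fun _ => rfl
    · rintro ⟨y, σ⟩ ⟨y', σ'⟩ h
      simp only at h
      have hy : y = y' := by
        refine Subtype.ext ((StrictMono.range_inj y.2 y'.2).1 ?_)
        rw [← σ.surjective.range_comp y.1, h, σ'.surjective.range_comp]
      subst hy
      congr 1
      ext i
      exact congrArg _ (y.2.injective (congrFun h i))
    · intro p hp
      have hninj : ¬ Function.Injective p := by
        intro hinj
        refine hp ⟨(⟨p ∘ Tuple.sort p, (Tuple.monotone_sort p).strictMono_of_injective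
          (hinj.comp (Tuple.sort p).injective)⟩, (Tuple.sort p)⁻¹), ?_⟩
        ext i
        simp
      simp only [Function.Injective, not_forall] at hninj
      obtain ⟨i, j, hij, hne⟩ := hninj
      rw [Matrix.det_zero_of_row_eq hne, mul_zero]
      ext k
      simp [hij]
  rw [← hreindex, Fintype.sum_prod_type]
  refine Finset.sum_congr rfl fun y _ => ?_
  have hperm : ∀ σ : Equiv.Perm (Fin N), (B.submatrix (y.1 ∘ σ) id).det =
      (Equiv.Perm.sign σ : R) * (B.submatrix y.1 id).det := fun σ => by
    rw [← Matrix.det_permute]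
    rfl
  rw [← Matrix.det_transpose, Matrix.det_apply', Finset.sum_mul]
  refine Finset.sum_congr rfl fun σ _ => ?_
  simp only [hperm, Matrix.transpose_apply, Matrix.submatrix_apply, id]
  ring

/-- A sum of weighted chains with a prescribed first point equals `1` if each transition has total
mass `1` when started from an admissible point, and leads to admissible points only. -/
theorem sum_prod_cons_eq_one {n : ℕ} (C : Fin (n + 1) → Type*) [∀ t, Fintype (C t)]
    (K : ∀ t : Fin n, C t.castSucc → C t.succ → ℝ) (G : ∀ t, C t → Prop)
    (hK : ∀ t a, G t.castSucc a → ∑ b, K t a b = 1)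
    (hG : ∀ t a b, K t a b ≠ 0 → G t.succ b) (a : C 0) (ha : G 0 a) :
    ∑ y : (∀ t : Fin n, C t.succ), ∏ t, K t (Fin.cons (α := C) a y t.castSucc)
      (Fin.cons (α := C) a y t.succ) = 1 := by
  induction n with
  | zero => simp
  | succ n ih =>
    rw [← (Fin.consEquiv fun t : Fin (n + 1) => C t.succ).sum_comp, Fintype.sum_prod_type]
    rw [← hK 0 a ha]
    refine Finset.sum_congr rfl fun b _ => ?_
    simp only [Fin.prod_univ_succ]
    change ∑ y : (∀ t : Fin n, C t.succ.succ), K 0 a b * ∏ t : Fin n, K t.succ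
      (Fin.cons (α := fun t : Fin (n + 1) => C t.succ) b y t.castSucc)
      (Fin.cons (α := fun t : Fin (n + 1) => C t.succ) b y t.succ) = K 0 a b
    -- Admissibility of `b`, needed for the induction hypothesis, is known only when the transition
    -- has nonzero weight.
    by_cases h0 : K 0 a b = 0
    · simp [h0]
    · rw [← Finset.mul_sum, ih (fun t => C t.succ) (fun t => K t.succ) (fun t => G t.succ)
        (fun t a => hK t.succ a) (fun t a b => hG t.succ a b) b (hG 0 a b h0), mul_one]

/-- A sum of weighted chains with a prescribed last point equals `1` if each transition has total
mass `1` when ended at an admissible point, and starts at admissible points only. -/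
theorem sum_prod_snoc_eq_one {n : ℕ} (C : Fin (n + 1) → Type*) [∀ t, Fintype (C t)]
    (K : ∀ t : Fin n, C t.castSucc → C t.succ → ℝ) (G : ∀ t, C t → Prop)
    (hK : ∀ t b, G t.succ b → ∑ a, K t a b = 1)
    (hG : ∀ t a b, K t a b ≠ 0 → G t.castSucc a) (b : C (Fin.last n)) (hb : G (Fin.last n) b) :
    ∑ y : (∀ t : Fin n, C t.castSucc), ∏ t, K t (Fin.snoc (α := C) y b t.castSucc)
      (Fin.snoc (α := C) y b t.succ) = 1 := by
  induction n with
  | zero => simp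
  | succ n ih =>
    rw [← (Fin.snocEquiv fun t : Fin (n + 1) => C t.castSucc).sum_comp, Fintype.sum_prod_type]
    rw [← hK (Fin.last n) b hb]
    refine Finset.sum_congr rfl fun a _ => ?_
    simp only [Fin.prod_univ_castSucc]
    have hlast : ∀ z, Fin.snoc (α := C) z b (Fin.last n).succ = b := fun z =>
      Fin.snoc_last (α := C) b z
    have hsucc : ∀ z (t : Fin n), Fin.snoc (α := C) z b t.castSucc.succ = z t.succ := fun z t =>
      Fin.snoc_castSucc (α := C) b z t.succ
    simp only [hlast, hsucc, Fin.snoc_castSucc, Fin.snocEquiv, Equiv.coe_fn_mk, Fin.snoc_last]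
    by_cases h0 : K (Fin.last n) a b = 0
    · simp [h0]
    · have := ih (fun t => C t.castSucc) (fun t => K t.castSucc) (fun t => G t.castSucc)
        (fun t a => hK t.castSucc a) (fun t a b => hG t.castSucc a b) a (hG _ a b h0)
      rw [← Finset.sum_mul]
      simp only [Fin.snoc_castSucc] at this
      rw [this, one_mul]

/-! ### Transition weights -/

/-- The weight of one step of a path: `a x` for an up-step, `b x` for a level step. -/
def stepWeight (a b : ℤ → ℝ) (x y : ℤ) : ℝ :=
  if y = x + 1 then a x else if y = x then b x else 0

theorem stepWeight_eq_zero {a b : ℤ → ℝ} {x y : ℤ} (h : ¬(y - x = 0 ∨ y - x = 1)) :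
    stepWeight a b x y = 0 := by
  rw [stepWeight, if_neg (by omega), if_neg (by omega)]

/-- `Y` is obtained from `X` by level steps and up-steps. -/
def IsStep {N T S t S' t' : ℕ} (X : Config N T S t) (Y : Config N T S' t') : Prop :=
  ∀ i, Y.pt i - X.pt i = 0 ∨ Y.pt i - X.pt i = 1

namespace Config

variable {N T S t : ℕ}

theorem pt_strictMono (X : Config N T S t) : StrictMono X.pt := fun _ _ h => X.2 h

theorem pt_mem (X : Config N T S t) (i : Fin N) : X.pt i ∈ vertSection N T S t := (X.1 i).2

theorem pt_bounds (X : Config N T S t) (i : Fin N) :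
    0 ≤ X.pt i ∧ (t : ℤ) + S - T ≤ X.pt i ∧ X.pt i ≤ (t : ℤ) + N - 1 ∧
      X.pt i ≤ (S : ℤ) + N - 1 := by
  have h := X.pt_mem i
  simp only [vertSection, Finset.mem_Icc] at h
  omega

theorem ext_pt {X Y : Config N T S t} (h : ∀ i, X.pt i = Y.pt i) : X = Y :=
  Subtype.ext (funext fun i => Subtype.ext (h i))

theorem vdm_pos (X : Config N T S t) : 0 < vdm X := by
  refine Finset.prod_pos fun i _ => Finset.prod_pos fun j hj => ?_
  rw [sub_pos, Int.cast_lt]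
  exact X.pt_strictMono (Finset.mem_Ioi.1 hj)

end Config

/-- There are only `N` integers in the interval, so none is skipped. The sections at times `0` and
`T` have this form, which forces the end configurations. -/
theorem eq_add_of_strictMono {N : ℕ} {f : Fin N → ℤ} (hf : StrictMono f) {a : ℤ}
    (hlo : ∀ i, a ≤ f i) (hhi : ∀ i, f i ≤ a + N - 1) (i : Fin N) : f i = a + (i : ℕ) := by
  have hlow : ∀ n (h : n < N), a + n ≤ f ⟨n, h⟩ := by
    intro n
    induction n with
    | zero => intro h; simpa using hlo _
    | succ n ih =>
      intro h
      have h1 := ih (by omega)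
      have h2 : f ⟨n, by omega⟩ < f ⟨n + 1, h⟩ := hf (by simp)
      push_cast
      omega
  have hup : ∀ n (h : n < N), f ⟨N - 1 - n, by omega⟩ ≤ a + N - 1 - n := by
    intro n
    induction n with
    | zero => intro h; simpa using hhi _
    | succ n ih =>
      intro h
      have h1 := ih (by omega)
      have h2 : f ⟨N - 1 - (n + 1), by omega⟩ < f ⟨N - 1 - n, by omega⟩ :=
        hf (by simp only [Fin.mk_lt_mk]; omega)
      push_cast
      omega
  have h1 := hlow i i.2
  have h2 := hup (N - 1 - i) (by have := i.2; omega)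
  have h3 : (⟨N - 1 - (N - 1 - (i : ℕ)), by have := i.2; omega⟩ : Fin N) = i := by
    ext
    have := i.2
    simp only
    omega
  rw [h3] at h2
  have := i.2
  simp only [Fin.eta] at h1
  omega

namespace Config

variable {N T S : ℕ}

theorem pt_zero (X : Config N T S 0) (i : Fin N) : X.pt i = (i : ℕ) := by
  rw [eq_add_of_strictMono X.pt_strictMono (a := 0) (fun i => (X.pt_bounds i).1)
    (fun i => by have := X.pt_bounds i; push_cast at this; omega), zero_add]

theorem pt_last (X : Config N T S T) (i : Fin N) : X.pt i = (S : ℤ) + (i : ℕ) :=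
  eq_add_of_strictMono X.pt_strictMono (fun i => by have := X.pt_bounds i; omega)
    (fun i => by have := X.pt_bounds i; omega) i

theorem subsingleton_zero : Subsingleton (Config N T S 0) :=
  ⟨fun X Y => ext_pt fun i => by rw [X.pt_zero, Y.pt_zero]⟩

theorem subsingleton_last : Subsingleton (Config N T S T) :=
  ⟨fun X Y => ext_pt fun i => by rw [X.pt_last, Y.pt_last]⟩

theorem nonempty {t : ℕ} (hS : S ≤ T) (ht : t ≤ T) : Nonempty (Config N T S t) :=
  ⟨⟨fun i => ⟨max 0 ((t : ℤ) + S - T) + (i : ℕ), by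
      have := i.2
      simp only [vertSection, Finset.mem_Icc]
      omega⟩, fun i j h => by
      rw [← Subtype.coe_lt_coe]
      have : (i : ℕ) < j := h
      simp only
      omega⟩⟩

end Config

/-- Particles moving by 0 or 1 cannot overtake each other: a nonzero term of the expansion has a
monotone permutation, hence the identity. -/
theorem det_stepWeight {N : ℕ} (a b : ℤ → ℝ) {x y : Fin N → ℤ} (hx : StrictMono x)
    (hy : StrictMono y) :
    (Matrix.of fun i j => stepWeight a b (x i) (y j)).det = ∏ i, stepWeight a b (x i) (y i) := by
  rw [← Matrix.det_transpose, Matrix.det_apply', Finset.sum_eq_single 1]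
  · simp
  · intro σ _ hσ
    refine mul_eq_zero_of_right _ ?_
    by_contra hne
    have hnz : ∀ i, y (σ i) - x i = 0 ∨ y (σ i) - x i = 1 := by
      intro i
      by_contra hi
      exact hne (Finset.prod_eq_zero (Finset.mem_univ i) (by simp [stepWeight_eq_zero hi]))
    have hmono : StrictMono σ := by
      intro i j hij
      refine lt_of_le_of_ne (le_of_not_gt fun hlt => ?_) (σ.injective.ne hij.ne)
      have h1 := hy hlt
      have h2 := hx hij
      have h3 := hnz i
      have h4 := hnz j
      omega
    refine hσ (Equiv.ext fun i => ?_)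
    have : Set.range σ = Set.range (id : Fin N → Fin N) := by
      rw [σ.surjective.range_eq, Set.range_id]
    exact congrFun ((StrictMono.range_inj hmono strictMono_id).1 this) i
  · simp

/-- Cauchy–Binet summed over the intermediate configuration. The hypotheses `ha` and `hb` say that
steps leaving the intermediate section have weight zero, so truncating to it loses nothing. -/
theorem sum_config_stepWeight {N T S t S₁ t₁ S₂ t₂ : ℕ} (a b c d : ℤ → ℝ)
    (X : Config N T S t) (Z : Config N T S₂ t₂)
    (ha : ∀ i, X.pt i + 1 ∈ vertSection N T S₁ t₁ ∨ a (X.pt i) = 0)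
    (hb : ∀ i, X.pt i ∈ vertSection N T S₁ t₁ ∨ b (X.pt i) = 0) :
    ∑ Y : Config N T S₁ t₁, (∏ i, stepWeight a b (X.pt i) (Y.pt i)) *
        ∏ i, stepWeight c d (Y.pt i) (Z.pt i) =
      (Matrix.of fun i j => a (X.pt i) * stepWeight c d (X.pt i + 1) (Z.pt j) +
        b (X.pt i) * stepWeight c d (X.pt i) (Z.pt j)).det := by
  have hmul : (Matrix.of fun i j => a (X.pt i) * stepWeight c d (X.pt i + 1) (Z.pt j) +
      b (X.pt i) * stepWeight c d (X.pt i) (Z.pt j)) =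
      (Matrix.of fun (i : Fin N) (y : vertSection N T S₁ t₁) => stepWeight a b (X.pt i) y) *
      (Matrix.of fun (y : vertSection N T S₁ t₁) (j : Fin N) => stepWeight c d y (Z.pt j)) := by
    ext i j
    simp only [Matrix.mul_apply, Matrix.of_apply]
    rw [Finset.sum_coe_sort (vertSection N T S₁ t₁)
      fun y => stepWeight a b (X.pt i) y * stepWeight c d y (Z.pt j)]
    have hsplit : ∀ y, stepWeight a b (X.pt i) y * stepWeight c d y (Z.pt j) =
        (if y = X.pt i + 1 then a (X.pt i) * stepWeight c d (X.pt i + 1) (Z.pt j) else 0) +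
        if y = X.pt i then b (X.pt i) * stepWeight c d (X.pt i) (Z.pt j) else 0 := by
      intro y
      by_cases h1 : y = X.pt i + 1
      · subst h1
        simp [stepWeight]
      · by_cases h2 : y = X.pt i
        · subst h2
          simp [stepWeight]
        · simp [stepWeight, h1, h2]
    simp only [hsplit, Finset.sum_add_distrib, Finset.sum_ite_eq']
    congr 1
    · split_ifs with h
      · rfl
      · rw [(ha i).resolve_left h, zero_mul]
    · split_ifs with h
      · rfl
      · rw [(hb i).resolve_left h, zero_mul]
  rw [hmul]
  refine Eq.trans ?_ (det_mul_eq_sum_strictMono _ _).symm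
  refine Finset.sum_congr rfl fun Y _ => ?_
  exact congrArg₂ (· * ·) (det_stepWeight a b X.pt_strictMono (Config.pt_strictMono Y)).symm
    (det_stepWeight c d (Config.pt_strictMono Y) Z.pt_strictMono).symm

theorem prod_filter_mul_prod_filter_eq_stepWeight {N : ℕ} (a b : ℤ → ℝ) {x y : Fin N → ℤ}
    (h : ∀ i, y i - x i = 0 ∨ y i - x i = 1) :
    (∏ i with y i = x i + 1, a (x i)) * (∏ i with y i = x i, b (x i)) =
      ∏ i, stepWeight a b (x i) (y i) := by
  rw [Finset.prod_filter, Finset.prod_filter, ← Finset.prod_mul_distrib]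
  refine Finset.prod_congr rfl fun i _ => ?_
  rcases h i with h | h
  · have : y i = x i := by omega
    simp [stepWeight, this]
  · have : y i = x i + 1 := by omega
    simp [stepWeight, this]

/-- Separates the Vandermonde ratio from a product over particles, the form to which Cauchy–Binet
applies. -/
theorem PtPlus_apply (N T S t : ℕ) (X : Config N T S t) (Y : Config N T S (t + 1)) :
    PtPlus N T S t X Y = vdm Y / ((ascPochhammer ℝ N).eval ((T : ℝ) - t) * vdm X) *
      ∏ i, stepWeight (fun x => (N : ℝ) + S - x - 1) (fun x => (x : ℝ) + T - t - S)
        (X.pt i) (Y.pt i) := by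
  classical
  rw [PtPlus, Matrix.of_apply]
  split_ifs with h
  · rw [← prod_filter_mul_prod_filter_eq_stepWeight _ _ h]
    simp only [mul_assoc, mul_div_right_comm]
  · obtain ⟨i, hi⟩ := not_forall.1 h
    rw [Finset.prod_eq_zero (Finset.mem_univ i) (stepWeight_eq_zero hi), mul_zero]

theorem PSPlus_apply (N T S t : ℕ) (X : Config N T S t) (Y : Config N T (S + 1) t) :
    PSPlus N T S t X Y = vdm Y / ((ascPochhammer ℝ N).eval ((T : ℝ) - S) * vdm X) *
      ∏ i, stepWeight (fun x => (N : ℝ) + t - x - 1) (fun x => (x : ℝ) + T - t - S)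
        (X.pt i) (Y.pt i) := by
  classical
  rw [PSPlus, Matrix.of_apply]
  split_ifs with h
  · rw [← prod_filter_mul_prod_filter_eq_stepWeight _ _ h]
    simp only [mul_assoc, mul_div_right_comm]
  · obtain ⟨i, hi⟩ := not_forall.1 h
    rw [Finset.prod_eq_zero (Finset.mem_univ i) (stepWeight_eq_zero hi), mul_zero]

/-- The single-path weights commute. -/
theorem stepWeight_comm (N T S t : ℕ) (x z : ℤ) :
    ((N : ℝ) + S - x - 1) * stepWeight (fun y => (N : ℝ) + (t + 1 : ℕ) - y - 1)
        (fun y => (y : ℝ) + T - (t + 1 : ℕ) - S) (x + 1) z +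
      ((x : ℝ) + T - t - S) * stepWeight (fun y => (N : ℝ) + (t + 1 : ℕ) - y - 1)
        (fun y => (y : ℝ) + T - (t + 1 : ℕ) - S) x z =
    ((N : ℝ) + t - x - 1) * stepWeight (fun y => (N : ℝ) + (S + 1 : ℕ) - y - 1)
        (fun y => (y : ℝ) + T - t - (S + 1 : ℕ)) (x + 1) z +
      ((x : ℝ) + T - t - S) * stepWeight (fun y => (N : ℝ) + (S + 1 : ℕ) - y - 1)
        (fun y => (y : ℝ) + T - t - (S + 1 : ℕ)) x z := by
  simp only [stepWeight]
  split_ifs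
  all_goals first
    | omega
    | (push_cast; ring)

/-- The two kinds of transition matrices commute. -/
theorem PtPlus_mul_PSPlus (N T S t : ℕ) :
    PtPlus N T S t * PSPlus N T S (t + 1) = PSPlus N T S t * PtPlus N T (S + 1) t := by
  ext X Z
  -- The intermediate Vandermonde product cancels, leaving only those of `X` and `Z`.
  have hcancel : ∀ {v w y p q c d : ℝ}, y ≠ 0 →
      y / (c * v) * p * (w / (d * y) * q) = w / (c * d * v) * (p * q) := by
    intro v w y p q c d hy
    simp only [div_eq_mul_inv, mul_inv]
    field_simp
  simp only [Matrix.mul_apply, PtPlus_apply, PSPlus_apply]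
  rw [Finset.sum_congr rfl fun Y _ => hcancel (Config.vdm_pos Y).ne',
    Finset.sum_congr rfl fun Y _ => hcancel (Config.vdm_pos Y).ne',
    ← Finset.mul_sum, ← Finset.mul_sum, sum_config_stepWeight, sum_config_stepWeight]
  · congr 1
    · congr 1
      ring
    · congr 1
      ext i j
      exact stepWeight_comm N T S t (X.pt i) (Z.pt j)
  -- In this and the remaining goals, the only position from which the step leaves the section is a
  -- zero of its weight.
  · intro i
    have := X.pt_bounds i
    by_cases h : X.pt i = t + N - 1
    · right
      simp only [h]
      push_cast
      ring
    · left
      simp only [vertSection, Finset.mem_Icc]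
      omega
  · intro i
    have := X.pt_bounds i
    by_cases h : X.pt i = (t : ℤ) + S - T
    · right
      simp [h]
    · left
      simp only [vertSection, Finset.mem_Icc]
      omega
  · intro i
    have := X.pt_bounds i
    by_cases h : X.pt i = S + N - 1
    · right
      simp only [h]
      push_cast
      ring
    · left
      simp only [vertSection, Finset.mem_Icc]
      omega
  · intro i
    have := X.pt_bounds i
    by_cases h : X.pt i = (t : ℤ) + S - T
    · right
      simp [h]
    · left
      simp only [vertSection, Finset.mem_Icc]
      omega

/-! ### Positivity -/

theorem PtPlus_pos {N T S t : ℕ} (ht : t < T) {X : Config N T S t} {Y : Config N T S (t + 1)}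
    (h : IsStep X Y) : 0 < PtPlus N T S t X Y := by
  rw [PtPlus_apply]
  have hT : (0 : ℝ) < (T : ℝ) - t := by
    rw [sub_pos]
    exact_mod_cast ht
  refine mul_pos (div_pos Y.vdm_pos (mul_pos (ascPochhammer_pos N _ hT) X.vdm_pos))
    (Finset.prod_pos fun i _ => ?_)
  -- The bounds on the target `Y` exclude exactly the zeros of the weights.
  have hY := Y.pt_bounds i
  rcases h i with h | h
  · rw [stepWeight, if_neg (by omega), if_pos (by omega)]
    have h0 : 0 < X.pt i + T - t - S := by omega
    exact_mod_cast h0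
  · rw [stepWeight, if_pos (by omega)]
    have h0 : 0 < (N : ℤ) + S - X.pt i - 1 := by omega
    exact_mod_cast h0

theorem PSPlus_pos {N T S t : ℕ} (hS : S < T) {X : Config N T S t} {Y : Config N T (S + 1) t}
    (h : IsStep X Y) : 0 < PSPlus N T S t X Y := by
  rw [PSPlus_apply]
  have hT : (0 : ℝ) < (T : ℝ) - S := by
    rw [sub_pos]
    exact_mod_cast hS
  refine mul_pos (div_pos Y.vdm_pos (mul_pos (ascPochhammer_pos N _ hT) X.vdm_pos))
    (Finset.prod_pos fun i _ => ?_)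
  have hY := Y.pt_bounds i
  rcases h i with h | h
  · rw [stepWeight, if_neg (by omega), if_pos (by omega)]
    have h0 : 0 < X.pt i + T - t - S := by omega
    exact_mod_cast h0
  · rw [stepWeight, if_pos (by omega)]
    have h0 : 0 < (N : ℤ) + t - X.pt i - 1 := by omega
    exact_mod_cast h0

theorem PtPlus_eq_zero {N T S t : ℕ} {X : Config N T S t} {Y : Config N T S (t + 1)}
    (h : ¬ IsStep X Y) : PtPlus N T S t X Y = 0 := by
  rw [PtPlus, Matrix.of_apply]
  exact if_neg h

theorem PSPlus_eq_zero {N T S t : ℕ} {X : Config N T S t} {Y : Config N T (S + 1) t}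
    (h : ¬ IsStep X Y) : PSPlus N T S t X Y = 0 := by
  rw [PSPlus, Matrix.of_apply]
  exact if_neg h

theorem PtPlus_nonneg {N T S t : ℕ} (ht : t < T) (X : Config N T S t)
    (Y : Config N T S (t + 1)) : 0 ≤ PtPlus N T S t X Y := by
  by_cases h : IsStep X Y
  · exact (PtPlus_pos ht h).le
  · exact (PtPlus_eq_zero h).ge

theorem PSPlus_nonneg {N T S t : ℕ} (hS : S < T) (X : Config N T S t)
    (Y : Config N T (S + 1) t) : 0 ≤ PSPlus N T S t X Y := by
  by_cases h : IsStep X Y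
  · exact (PSPlus_pos hS h).le
  · exact (PSPlus_eq_zero h).ge

theorem PtPlus_mul_PSPlus_nonneg {N T S t : ℕ} (hS : S < T) (ht : t < T) (X : Config N T S t)
    (Z : Config N T (S + 1) (t + 1)) :
    0 ≤ (PtPlus N T S t * PSPlus N T S (t + 1)) X Z :=
  Finset.sum_nonneg fun Y _ => mul_nonneg (PtPlus_nonneg ht X Y) (PSPlus_nonneg hS Y Z)

theorem PtPlus_mul_PSPlus_pos {N T S t : ℕ} (hS : S < T) (ht : t < T) {X : Config N T S t}
    {Y : Config N T S (t + 1)} {Z : Config N T (S + 1) (t + 1)} (hXY : IsStep X Y)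
    (hYZ : IsStep Y Z) : 0 < (PtPlus N T S t * PSPlus N T S (t + 1)) X Z :=
  Finset.sum_pos' (fun Y _ => mul_nonneg (PtPlus_nonneg ht X Y) (PSPlus_nonneg hS Y Z))
    ⟨Y, Finset.mem_univ _, mul_pos (PtPlus_pos ht hXY) (PSPlus_pos hS hYZ)⟩

/-- Commutation lets the intermediate configuration lie at the old time with the new height
parameter; this keeps the forward chain alive. -/
theorem PtPlus_mul_PSPlus_pos' {N T S t : ℕ} (hS : S < T) (ht : t < T) {X : Config N T S t}
    {Y : Config N T (S + 1) t} {Z : Config N T (S + 1) (t + 1)} (hXY : IsStep X Y)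
    (hYZ : IsStep Y Z) : 0 < (PtPlus N T S t * PSPlus N T S (t + 1)) X Z := by
  rw [PtPlus_mul_PSPlus]
  exact Finset.sum_pos' (fun Y _ => mul_nonneg (PSPlus_nonneg hS X Y) (PtPlus_nonneg ht Y Z))
    ⟨Y, Finset.mem_univ _, mul_pos (PSPlus_pos hS hXY) (PtPlus_pos ht hYZ)⟩

/-! ### Path families as chains of configurations -/

namespace PathFamily

variable {N T S : ℕ}

/-- The chain of configurations of a path family. -/
def slices (X : PathFamily N T S) (t : Fin (T + 1)) : Config N T S t :=
  X.slice t (Nat.le_of_lt_succ t.2)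

theorem pt_slices (X : PathFamily N T S) (t : Fin (T + 1)) (i : Fin N) :
    (X.slices t).pt i = X.path i t := rfl

theorem slices_injective : Function.Injective (slices : PathFamily N T S → _) := fun X Y h => by
  ext i t
  rw [← pt_slices, ← pt_slices, h]

theorem isStep_slices (X : PathFamily N T S) (t : Fin T) :
    IsStep (X.slices t.castSucc) (X.slices t.succ) := fun i => X.step i t

/-- A chain of configurations in which consecutive members differ by a step is a path family. -/
theorem exists_slices_eq {y : ∀ t : Fin (T + 1), Config N T S t}
    (hy : ∀ t : Fin T, IsStep (y t.castSucc) (y t.succ)) :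
    ∃ Y : PathFamily N T S, Y.slices = y :=
  ⟨{  path := fun i t => (y t).pt i
      -- The endpoint conditions are automatic, since the first and last sections contain a single
      -- configuration.
      start := fun i => (y 0).pt_zero i
      finish := fun i => Config.pt_last (S := S) (y (Fin.last T)) i
      step := fun i t => hy t i
      nonIntersecting := fun _ _ hij t => (y t).pt_strictMono.injective.ne hij },
    funext fun _ => rfl⟩

/-- Replaces path families by unrestricted chains, to which the sums over `Fin.cons` and `Fin.snoc`
apply. -/
theorem sum_slices (f : (∀ t : Fin (T + 1), Config N T S t) → ℝ)
    (hf : ∀ y, ∀ t : Fin T, ¬ IsStep (y t.castSucc) (y t.succ) → f y = 0) :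
    ∑ Y : PathFamily N T S, f Y.slices = ∑ y, f y := by
  refine Fintype.sum_of_injective slices slices_injective _ _ ?_ fun _ => rfl
  intro y hy
  by_contra hne
  refine hy (exists_slices_eq fun t => ?_)
  by_contra ht
  exact hne (hf y t ht)

theorem slices_zero_eq (X Y : PathFamily N T S) : X.slices 0 = Y.slices 0 :=
  Config.subsingleton_zero.elim _ _

theorem slices_last_eq (X Y : PathFamily N T S) : X.slices (Fin.last T) = Y.slices (Fin.last T) :=
  Config.subsingleton_last.elim (α := Config N T S T) _ _

end PathFamily

/-! ### The weight of a path family -/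

/-- If the weight of an up-step depends only on the height, and the weight of a level step only on
the height minus the time, then the weight of a path depends only on its endpoints. -/
theorem prod_stepWeight_path (a b : ℤ → ℝ) {n : ℕ} (x : Fin (n + 1) → ℤ)
    (hx : ∀ t : Fin n, x t.succ - x t.castSucc = 0 ∨ x t.succ - x t.castSucc = 1) :
    ∃ u l : ℕ, x (Fin.last n) = x 0 + u ∧ n = u + l ∧
      ∏ t : Fin n, stepWeight a (fun z => b (z - t)) (x t.castSucc) (x t.succ) =
        (∏ h ∈ range u, a (x 0 + h)) * ∏ k ∈ range l, b (x 0 - k) := by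
  induction n with
  | zero => exact ⟨0, 0, by simp, rfl, by simp⟩
  | succ n ih =>
    obtain ⟨u, l, hu, hn, hprod⟩ := ih (fun t => x t.castSucc) (fun t => hx t.castSucc)
    have hlast := hx (Fin.last n)
    have hend : (Fin.last n).succ = Fin.last (n + 1) := rfl
    rw [Fin.prod_univ_castSucc]
    simp only [Fin.castSucc_zero] at hu hprod
    simp only [Fin.val_castSucc, Fin.val_last, ← Fin.castSucc_succ, hprod]
    rw [hend] at hlast ⊢
    rcases hlast with h | h
    -- Height minus time drops by one at each level step, so here it equals `x 0 - l` whatever the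
    -- order of the steps.
    · refine ⟨u, l + 1, by omega, by omega, ?_⟩
      rw [stepWeight, if_neg (by omega), if_pos (by omega), Finset.prod_range_succ, ← mul_assoc]
      congr 2
      omega
    · refine ⟨u + 1, l, by push_cast; omega, by omega, ?_⟩
      rw [stepWeight, if_pos (by omega), Finset.prod_range_succ, mul_right_comm, hu]

/-- The product of the transition weights along a path family. -/
def chainWeight {N T S : ℕ} (X : PathFamily N T S) : ℝ :=
  ∏ t : Fin T, PtPlus N T S t (X.slices t.castSucc) (X.slices t.succ)

theorem chainWeight_pos {N T S : ℕ} (X : PathFamily N T S) : 0 < chainWeight X :=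
  Finset.prod_pos fun t _ => PtPlus_pos t.2 (X.isStep_slices t)

/-- The Vandermonde ratios telescope, the Pochhammer factors depend on time alone, and the step
weights along each path depend only on its endpoints. -/
theorem chainWeight_eq {N T S : ℕ} (X Y : PathFamily N T S) : chainWeight X = chainWeight Y := by
  have hvdm : ∀ Z : PathFamily N T S, ∏ t : Fin T,
      (vdm (Z.slices t.succ) / vdm (Z.slices t.castSucc)) =
        vdm (Z.slices (Fin.last T)) / vdm (Z.slices 0) := by
    intro Z
    have h := (Fin.prod_univ_succ fun t => vdm (Z.slices t)).symm.trans
      (Fin.prod_univ_castSucc fun t => vdm (Z.slices t))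
    rw [Finset.prod_div_distrib, div_eq_div_iff
      (Finset.prod_pos fun t _ => Config.vdm_pos _).ne' (Config.vdm_pos _).ne', mul_comm, h,
      mul_comm]
  have hpath : ∀ i, ∏ t : Fin T, stepWeight (fun x => (N : ℝ) + S - x - 1)
      (fun x => (x : ℝ) + T - t - S) (X.path i t.castSucc) (X.path i t.succ) =
      ∏ t : Fin T, stepWeight (fun x => (N : ℝ) + S - x - 1)
      (fun x => (x : ℝ) + T - t - S) (Y.path i t.castSucc) (Y.path i t.succ) := by
    intro i
    have hb : ∀ t : Fin T, (fun x : ℤ => (x : ℝ) + T - t - S) =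
        fun x : ℤ => (fun z : ℤ => (z : ℝ) + T - S) (x - (t : ℕ)) := by
      intro t
      ext x
      push_cast
      ring
    simp only [hb]
    obtain ⟨u, l, hu, hn, h⟩ := prod_stepWeight_path (fun x => (N : ℝ) + S - x - 1)
      (fun z : ℤ => (z : ℝ) + T - S) (X.path i) (X.step i)
    obtain ⟨u', l', hu', hn', h'⟩ := prod_stepWeight_path (fun x => (N : ℝ) + S - x - 1)
      (fun z : ℤ => (z : ℝ) + T - S) (Y.path i) (Y.step i)
    rw [h, h']
    rw [X.finish, X.start] at hu
    rw [Y.finish, Y.start] at hu'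
    rw [X.start, Y.start]
    obtain rfl : u = u' := by omega
    obtain rfl : l = l' := by omega
    rfl
  have hsplit : ∀ Z : PathFamily N T S, chainWeight Z =
      (∏ t : Fin T, (1 / (ascPochhammer ℝ N).eval ((T : ℝ) - (t : ℕ)))) *
        (∏ t : Fin T, (vdm (Z.slices t.succ) / vdm (Z.slices t.castSucc))) *
        ∏ i, ∏ t : Fin T, stepWeight (fun x => (N : ℝ) + S - x - 1)
          (fun x => (x : ℝ) + T - t - S) (Z.path i t.castSucc) (Z.path i t.succ) := by
    intro Z
    rw [Finset.prod_comm, ← Finset.prod_mul_distrib, ← Finset.prod_mul_distrib]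
    refine Finset.prod_congr rfl fun t _ => ?_
    refine (PtPlus_apply N T S t (Z.slices t.castSucc) (Z.slices t.succ)).trans ?_
    rw [div_mul_div_comm, one_mul]
    rfl
  rw [hsplit X, hsplit Y, hvdm, hvdm, X.slices_zero_eq Y, X.slices_last_eq Y,
    Finset.prod_congr rfl fun i _ => hpath i]

/-! ### The matrix `stepDown` -/

/-- The factor of `stepDown` at time `t`. -/
def stepDownFactor {N T S : ℕ} (t : Fin T) (a : Config N T S t) (b : Config N T S (t + 1))
    (x : Config N T (S + 1) (t + 1)) : ℝ :=
  PtPlus N T S t a b * PSPlus N T S (t + 1) b x / (PtPlus N T S t * PSPlus N T S (t + 1)) a x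

/-- The positivity test is redundant: the denominators are nonnegative, so if it fails one of them
is zero, and division by zero gives a zero factor. -/
theorem stepDown_apply {N T S : ℕ} (hS : S < T) (X : PathFamily N T (S + 1))
    (Y : PathFamily N T S) :
    stepDown N T S X Y = ∏ t : Fin T,
      stepDownFactor t (Y.slices t.castSucc) (Y.slices t.succ) (X.slices t.succ) := by
  rw [stepDown, Matrix.of_apply]
  split_ifs with h
  · rfl
  · by_contra hne
    refine h (Finset.prod_pos fun t _ => lt_of_le_of_ne
      (PtPlus_mul_PSPlus_nonneg hS t.2 _ _) fun h0 => ?_)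
    refine hne (Finset.prod_eq_zero (Finset.mem_univ t) ?_).symm
    rw [stepDownFactor]
    exact (congrArg _ h0.symm).trans (div_zero _)

theorem stepDown_nonneg {N T S : ℕ} (hS : S < T) (X : PathFamily N T (S + 1))
    (Y : PathFamily N T S) : 0 ≤ stepDown N T S X Y := by
  rw [stepDown_apply hS]
  exact Finset.prod_nonneg fun t _ => div_nonneg
    (mul_nonneg (PtPlus_nonneg t.2 _ _) (PSPlus_nonneg hS _ _))
    (PtPlus_mul_PSPlus_nonneg hS t.2 _ _)

theorem isStep_zero {N T S S' : ℕ} (X : Config N T S 0) (Y : Config N T S' 0) : IsStep X Y :=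
  fun i => by
    left
    rw [X.pt_zero, Y.pt_zero, sub_self]

theorem isStep_last {N T S : ℕ} (X : Config N T S T) (Y : Config N T (S + 1) T) : IsStep X Y :=
  fun i => by
    right
    rw [X.pt_last, Y.pt_last]
    push_cast
    ring

/-- Forward chain with `X` fixed; `Y(t)` is admissible when `X(t)` is reachable from it. The
numerators sum to the denominator by definition of the matrix product. -/
theorem sum_stepDown_row {N T S : ℕ} (hS : S < T) (X : PathFamily N T (S + 1)) :
    ∑ Y, stepDown N T S X Y = 1 := by
  simp only [stepDown_apply hS X]
  rw [PathFamily.sum_slices fun y => ∏ t : Fin T,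
    stepDownFactor t (y t.castSucc) (y t.succ) (X.slices t.succ)]
  · obtain ⟨a₀⟩ : Nonempty (Config N T S 0) := Config.nonempty hS.le (Nat.zero_le T)
    rw [← (Fin.consEquiv fun t : Fin (T + 1) => Config N T S t).sum_comp,
      Fintype.sum_prod_type]
    refine (Fintype.sum_eq_single a₀ fun a ha =>
      (ha (Config.subsingleton_zero.elim _ _)).elim).trans ?_
    refine sum_prod_cons_eq_one (fun t : Fin (T + 1) => Config N T S t)
      (fun t a b => stepDownFactor t a b (X.slices t.succ))
      (fun t a => IsStep a (X.slices t)) ?_ ?_ a₀ (isStep_zero a₀ _)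
    · intro t a ha
      simp only [stepDownFactor]
      rw [← Finset.sum_div]
      exact div_self (PtPlus_mul_PSPlus_pos' hS t.2 ha (X.isStep_slices t)).ne'
    · intro t a b hne
      by_contra hb
      refine hne ?_
      rw [stepDownFactor]
      exact div_eq_zero_iff.2 (Or.inl (mul_eq_zero_of_right _ (PSPlus_eq_zero hb)))
  · intro y t ht
    refine Finset.prod_eq_zero (Finset.mem_univ t) ?_
    rw [stepDownFactor]
    exact div_eq_zero_iff.2 (Or.inl (mul_eq_zero_of_left (PtPlus_eq_zero ht) _))

/-- The backward transition weight from `b` to `a` at time `t`, conditioned on `y`. -/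
def stepUpFactor {N T S : ℕ} (t : Fin T) (y : Config N T S t) (a : Config N T (S + 1) t)
    (b : Config N T (S + 1) (t + 1)) : ℝ :=
  PSPlus N T S t y a * PtPlus N T (S + 1) t a b / (PtPlus N T S t * PSPlus N T S (t + 1)) y b

/-- Backward chain with `Y` fixed. The numerators sum to an entry of `P_{S+} P_{t+}`, which
commutation identifies with the denominator. -/
theorem sum_stepUp {N T S : ℕ} (hS : S < T) (Y : PathFamily N T S) :
    ∑ X : PathFamily N T (S + 1), ∏ t : Fin T,
      stepUpFactor t (Y.slices t.castSucc) (X.slices t.castSucc) (X.slices t.succ) = 1 := by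
  rw [PathFamily.sum_slices fun x => ∏ t : Fin T,
    stepUpFactor t (Y.slices t.castSucc) (x t.castSucc) (x t.succ)]
  · obtain ⟨b₀⟩ : Nonempty (Config N T (S + 1) T) := Config.nonempty hS le_rfl
    rw [← (Fin.snocEquiv fun t : Fin (T + 1) => Config N T (S + 1) t).sum_comp,
      Fintype.sum_prod_type]
    refine (Fintype.sum_eq_single b₀ fun b hb =>
      (hb (Config.subsingleton_last.elim (α := Config N T (S + 1) T) _ _)).elim).trans ?_
    refine sum_prod_snoc_eq_one (fun t : Fin (T + 1) => Config N T (S + 1) t)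
      (fun t a b => stepUpFactor t (Y.slices t.castSucc) a b)
      (fun t b => IsStep (Y.slices t) b) ?_ ?_ b₀
      (isStep_last (Y.slices (Fin.last T) : Config N T S T) b₀)
    · intro t b hb
      simp only [stepUpFactor]
      rw [← Finset.sum_div]
      have hpos := PtPlus_mul_PSPlus_pos hS t.2 (Y.isStep_slices t) hb
      rw [div_eq_one_iff_eq hpos.ne', PtPlus_mul_PSPlus]
      rfl
    · intro t a b hne
      by_contra ha
      refine hne ?_
      rw [stepUpFactor]
      exact div_eq_zero_iff.2 (Or.inl (mul_eq_zero_of_left (PSPlus_eq_zero ha) _))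
  · intro x t ht
    refine Finset.prod_eq_zero (Finset.mem_univ t) ?_
    rw [stepUpFactor]
    exact div_eq_zero_iff.2 (Or.inl (mul_eq_zero_of_right _ (PtPlus_eq_zero ht)))

/-- A Bayes formula. The `P_{S+}` factors run over times `1, …, T` on one side and `0, …, T-1` on
the other, hence the two boundary factors. -/
theorem stepDown_mul_chainWeight {N T S : ℕ} (hS : S < T) (X : PathFamily N T (S + 1))
    (Y : PathFamily N T S) :
    PSPlus N T S (0 : Fin (T + 1)) (Y.slices 0) (X.slices 0) *
        (stepDown N T S X Y * chainWeight X) =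
      PSPlus N T S (Fin.last T) (Y.slices (Fin.last T)) (X.slices (Fin.last T)) *
        (chainWeight Y * ∏ t : Fin T,
          stepUpFactor t (Y.slices t.castSucc) (X.slices t.castSucc) (X.slices t.succ)) := by
  have h : PSPlus N T S (0 : Fin (T + 1)) (Y.slices 0) (X.slices 0) *
      ∏ t : Fin T, PSPlus N T S (t + 1) (Y.slices t.succ) (X.slices t.succ) =
      (∏ t : Fin T, PSPlus N T S t (Y.slices t.castSucc) (X.slices t.castSucc)) *
        PSPlus N T S (Fin.last T) (Y.slices (Fin.last T)) (X.slices (Fin.last T)) :=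
    (Fin.prod_univ_succ fun t => PSPlus N T S t (Y.slices t) (X.slices t)).symm.trans
    (Fin.prod_univ_castSucc fun t => PSPlus N T S t (Y.slices t) (X.slices t))
  simp only [stepDown_apply hS, chainWeight, stepDownFactor, stepUpFactor,
    Finset.prod_div_distrib, Finset.prod_mul_distrib]
  set A := ∏ t : Fin T, PtPlus N T S t (Y.slices t.castSucc) (Y.slices t.succ)
  set B := ∏ t : Fin T, PtPlus N T (S + 1) t (X.slices t.castSucc) (X.slices t.succ)
  set D := ∏ t : Fin T, (PtPlus N T S t * PSPlus N T S (t + 1)) (Y.slices t.castSucc)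
    (X.slices t.succ)
  linear_combination (A * B / D) * h

theorem sum_stepDown_column {N T S : ℕ} (hS : S < T) (X₀ : PathFamily N T (S + 1))
    (Y₀ Y : PathFamily N T S) :
    PSPlus N T S (0 : Fin (T + 1)) (Y₀.slices 0) (X₀.slices 0) *
        ((∑ X, stepDown N T S X Y) * chainWeight X₀) =
      PSPlus N T S (Fin.last T) (Y₀.slices (Fin.last T)) (X₀.slices (Fin.last T)) *
        chainWeight Y₀ := by
  have h := Finset.sum_congr rfl fun X (_ : X ∈ univ) => stepDown_mul_chainWeight hS X Y
  simp only [fun X => PathFamily.slices_zero_eq X X₀, fun X => PathFamily.slices_last_eq X X₀,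
    PathFamily.slices_zero_eq Y Y₀, PathFamily.slices_last_eq Y Y₀,
    fun X => chainWeight_eq X X₀, chainWeight_eq Y Y₀] at h
  rw [← Finset.mul_sum, ← Finset.mul_sum, ← Finset.sum_mul, ← Finset.mul_sum, sum_stepUp hS Y,
    mul_one] at h
  exact h

theorem unifMeasure_real_singleton {N T S : ℕ} (X : PathFamily N T S) :
    (unifMeasure N T S).real {X} = 1 / Fintype.card (PathFamily N T S) := by
  have : MeasurableSingletonClass (PathFamily N T S) := ⟨fun _ => trivial⟩
  rw [unifMeasure, MeasureTheory.measureReal_def, ProbabilityTheory.uniformOn_univ]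
  simp

theorem sum_stepDown_mul_unifMeasure {N T S : ℕ} (hS : S < T) (Y : PathFamily N T S) :
    (unifMeasure N T S).real {Y} =
      ∑ X, stepDown N T S X Y * (unifMeasure N T (S + 1)).real {X} := by
  simp only [unifMeasure_real_singleton]
  rw [← Finset.sum_mul]
  have hne : Nonempty (PathFamily N T (S + 1)) := by
    by_contra hempty
    rw [not_nonempty_iff] at hempty
    have := sum_stepUp hS Y
    simp at this
  obtain ⟨X₀⟩ := hne
  have hp : 0 < PSPlus N T S (0 : Fin (T + 1)) (Y.slices 0) (X₀.slices 0) :=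
    PSPlus_pos hS (isStep_zero (Y.slices 0) (X₀.slices 0))
  have hconst : ∀ Y', ∑ X, stepDown N T S X Y' = ∑ X, stepDown N T S X Y := fun Y' => by
    have h := (sum_stepDown_column hS X₀ Y Y').trans (sum_stepDown_column hS X₀ Y Y).symm
    exact mul_right_cancel₀ (chainWeight_pos X₀).ne' (mul_left_cancel₀ hp.ne' h)
  have htotal : (Fintype.card (PathFamily N T S) : ℝ) * ∑ X, stepDown N T S X Y =
      Fintype.card (PathFamily N T (S + 1)) := by
    have h : ∑ Y', ∑ X, stepDown N T S X Y' = ∑ X : PathFamily N T (S + 1), (1 : ℝ) := by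
      rw [Finset.sum_comm]
      exact Finset.sum_congr rfl fun X _ => sum_stepDown_row hS X
    simpa [hconst] using h
  have hX : (Fintype.card (PathFamily N T (S + 1)) : ℝ) ≠ 0 :=
    Nat.cast_ne_zero.2 (Fintype.card_pos_iff.2 ⟨X₀⟩).ne'
  have hY : (Fintype.card (PathFamily N T S) : ℝ) ≠ 0 :=
    Nat.cast_ne_zero.2 (Fintype.card_pos_iff.2 ⟨Y⟩).ne'
  rw [← htotal] at hX ⊢
  have hsum := right_ne_zero_of_mul hX
  field_simp

end LozengePaths

end

/-- The step matrix from `Ω(N,T,S+1)` to `Ω(N,T,S)` is stochastic and maps the uniform measure to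
the uniform measure (the larger of the two consecutive height parameters is written `S + 1`). -/
theorem mainTheorem4 (N T S : ℕ) (hS : S + 1 ≤ T) :
    LozengePaths.IsStochastic (LozengePaths.stepDown N T S) ∧
    ∀ Y : LozengePaths.PathFamily N T S,
      (LozengePaths.unifMeasure N T S).real {Y} =
        ∑ X : LozengePaths.PathFamily N T (S + 1),
          LozengePaths.stepDown N T S X Y * (LozengePaths.unifMeasure N T (S + 1)).real {X} := by
  exact ⟨⟨LozengePaths.stepDown_nonneg hS, LozengePaths.sum_stepDown_row hS⟩,
    LozengePaths.sum_stepDown_mul_unifMeasure hS⟩
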